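/- All graphs are finite and simple. For graphs $G$ and $H$, say that $G$ contains an induced $H$ if $G$ has an induced subgraph isomorphic to $H$, and that $G$ is $(2P_2,K_4)$-free if it contains neither an induced $2P_2$ (the disjoint union of two copies of the path $P_2$ on two vertices) nor an induced $K_4$. Two distinct nonadjacent vertices $u,v$ of $G$ are comparable if $N(u)\subseteq N(v)$ or $N(v)\subseteq N(u)$. Let $H_1$ be the graph on the seven vertices $1,2,3,4,5,6,w$ in which $\{1,2,3,4,5,6\}$ induces the complement $\overline{C_6}$ of the cycle $1,2,3,4,5,6$ (so its edges are $13,14,15,24,25,26,35,36,46$) and $w$ is adjacent to exactly $1,2,4,5$. Let $G$ be a connected $(2P_2,K_4)$-free graph with no pair of comparable vertices. If $G$ contains an induced $H_1$, then $\chi(G)\le 4$. -/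

import Mathlib

/-- `G` is `H`-free: `G` has no induced subgraph isomorphic to `H`. -/
def HFree {V W : Type*} (G : SimpleGraph V) (H : SimpleGraph W) : Prop :=
  ¬ H.IsIndContained G

/-- The graph `2P₂`: the disjoint union of two copies of the path on two vertices. -/
def twoP2 : SimpleGraph (Fin 2 ⊕ Fin 2) :=
  (SimpleGraph.pathGraph 2).sum (SimpleGraph.pathGraph 2)

/-- The special graph `H₁` on seven vertices. The vertices `1, …, 6` induce the complement of the
six-cycle `1 2 3 4 5 6`, and the vertex `0` is the additional vertex `w`, whose neighbors are
`1, 2, 4, 5`. -/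
def graphH1 : SimpleGraph (Fin 7) :=
  SimpleGraph.fromEdgeSet
    {s(1, 3), s(1, 4), s(1, 5), s(2, 4), s(2, 5), s(2, 6), s(3, 5), s(3, 6), s(4, 6),
     s(0, 1), s(0, 2), s(0, 4), s(0, 5)}

/-- Two distinct nonadjacent vertices are comparable if the neighborhood of one of them is
contained in the neighborhood of the other. -/
def Comparable {V : Type*} (G : SimpleGraph V) (u v : V) : Prop :=
  u ≠ v ∧ ¬ G.Adj u v ∧
    (G.neighborSet v ⊆ G.neighborSet u ∨ G.neighborSet u ⊆ G.neighborSet v)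

open SimpleGraph

/-! ### Forbidden configurations -/

/-! Fix an induced copy of `graphH1` and sort all vertices by their trace, the set of their
neighbors in this copy. Excluding `2P₂` and `K₄` restricts which traces occur and which pairs of
traces can belong to adjacent vertices. If the graph of possibly adjacent traces is loopless and
4-colorable, coloring each vertex by its trace colors `G`.

Otherwise branch on whether some trace is realized: if so, adjoin such a vertex, which refines all
traces; if not, delete that trace. Every leaf of the finite tree `treeH1` ends in a coloring or in a
comparable pair. `CaseTree.colorable_of_check` shows that a verified tree suffices; verification is
a kernel computation. -/

theorem HFree.not_two_edges {V : Type*} {G : SimpleGraph V} (h : HFree G twoP2) {a b c d : V}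
    (hab : G.Adj a b) (hcd : G.Adj c d) (hac : ¬ G.Adj a c) (had : ¬ G.Adj a d)
    (hbc : ¬ G.Adj b c) (hbd : ¬ G.Adj b d) : False := by
  have hac' : a ≠ c := by rintro rfl; exact had hcd
  have had' : a ≠ d := by rintro rfl; exact hac hcd.symm
  have hbc' : b ≠ c := by rintro rfl; exact hbd hcd
  have hbd' : b ≠ d := by rintro rfl; exact hbc hcd.symm
  refine h ⟨⟨⟨Sum.elim ![a, b] ![c, d], ?_⟩, ?_⟩⟩
  · rintro (i | i) (j | j) hij <;> fin_cases i <;> fin_cases j <;>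
      simp_all [hab.ne, hcd.ne, hab.ne', hcd.ne', eq_comm]
  · intro i j
    change G.Adj (Sum.elim ![a, b] ![c, d] i) (Sum.elim ![a, b] ![c, d] j) ↔ _
    rcases i with i | i <;> rcases j with j | j <;> fin_cases i <;> fin_cases j <;>
      simp_all [twoP2, pathGraph_adj, G.adj_comm]

theorem HFree.not_four_clique {V : Type*} {G : SimpleGraph V}
    (h : HFree G (completeGraph (Fin 4))) {a b c d : V}
    (hab : G.Adj a b) (hac : G.Adj a c) (had : G.Adj a d) (hbc : G.Adj b c) (hbd : G.Adj b d)
    (hcd : G.Adj c d) : False := by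
  refine h ⟨⟨⟨![a, b, c, d], ?_⟩, ?_⟩⟩
  · intro i j hij
    fin_cases i <;> fin_cases j <;>
      simp_all [hab.ne, hac.ne, had.ne, hbc.ne, hbd.ne, hcd.ne, hab.ne', hac.ne', had.ne',
        hbc.ne', hbd.ne', hcd.ne']
  · intro i j
    change G.Adj (![a, b, c, d] i) (![a, b, c, d] j) ↔ _
    fin_cases i <;> fin_cases j <;> simp_all [G.adj_comm]

/-! ### Traces

A vertex `v` is classified by its adjacencies to the vertices of a list `B`, recorded as the binary
digits of a natural number; the head of `B` is the lowest digit. -/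

open Classical in
/-- The set of neighbors of `v` in the list `B`, as a bit mask. -/
noncomputable def trace {V : Type*} (G : SimpleGraph V) : List V → V → ℕ
  | [], _ => 0
  | x :: B, v => Nat.bit (decide (G.Adj x v)) (trace G B v)

theorem trace_nil {V : Type*} (G : SimpleGraph V) (v : V) : trace G [] v = 0 := rfl

theorem trace_cons_of_adj {V : Type*} {G : SimpleGraph V} {x v : V} (h : G.Adj x v) (B : List V) :
    trace G (x :: B) v = 2 * trace G B v + 1 := by
  simp [trace, h]

theorem trace_cons_of_not_adj {V : Type*} {G : SimpleGraph V} {x v : V} (h : ¬ G.Adj x v)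
    (B : List V) : trace G (x :: B) v = 2 * trace G B v := by
  simp [trace, h]

theorem testBit_trace {V : Type*} (G : SimpleGraph V) (B : List V) (v : V) (i : ℕ) :
    (trace G B v).testBit i = true ↔ ∃ x, B[i]? = some x ∧ G.Adj x v := by
  induction B generalizing i with
  | nil => simp [trace]
  | cons x B ih => cases i <;> simp [trace, ih, Nat.testBit_bit_succ]

/-- A summary of a graph relative to a list of vertices: the traces of the vertices in the list,
and a list containing the traces of all vertices of the graph. -/
structure Config where
  /-- The traces of the vertices of the list, with their positions. -/
  masks : List (ℕ × ℕ)
  /-- The admissible traces. -/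
  types : List ℕ

namespace Config

/-- Vertices with traces `S` and `T` may be adjacent: there is no edge of the list among their
common neighbors, and none among their common nonneighbors. -/
def canAdj (s : Config) (S T : ℕ) : Bool :=
  s.masks.all fun p =>
    (Nat.beq (Nat.land p.1 (Nat.land S T)) 0 || !(Nat.land S T).testBit p.2) &&
      (Nat.beq (Nat.lor p.1 (Nat.lor S T)) (Nat.lor S T) || (Nat.lor S T).testBit p.2)

theorem canAdj_comm (s : Config) (S T : ℕ) : s.canAdj S T = s.canAdj T S := by
  have h1 : Nat.land S T = Nat.land T S := Nat.land_comm S T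
  have h2 : Nat.lor S T = Nat.lor T S := Nat.lor_comm S T
  rw [canAdj, canAdj, h1, h2]

/-- Vertices with traces `S` and `T` may be nonadjacent: every neighbor of the first one in the
list is adjacent to every neighbor of the second one in the list, unless one of these is a common
neighbor. -/
def canNonadj (s : Config) (S T : ℕ) : Bool :=
  s.masks.all fun p =>
    !S.testBit p.2 || T.testBit p.2 || Nat.beq (T ||| (S ||| p.1)) (S ||| p.1)

/-- Adjoin a vertex with trace `S` to the list. -/
def extend (s : Config) (S : ℕ) : Config where
  -- The new vertex takes position 0, so older positions shift by one; its own bit is clear because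
  -- adjacency is irreflexive.
  masks := (Nat.bit false S, 0) :: s.masks.map fun p => (Nat.bit (S.testBit p.2) p.1, p.2 + 1)
  types := s.types.flatMap fun T =>
    (bif s.canAdj S T then [Nat.bit true T] else []) ++
      (bif s.canNonadj S T then [Nat.bit false T] else [])

/-- Discard a trace. -/
def erase (s : Config) (S : ℕ) : Config where
  masks := s.masks
  types := s.types.filter fun T => !Nat.beq T S

/-- The admissible traces, those of the vertices of the list first. -/
def colorOrder (s : Config) : List ℕ :=
  s.masks.map Prod.fst ++ s.types.filter fun T => s.masks.all fun p => !Nat.beq p.1 T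

theorem mem_colorOrder {s : Config} {S : ℕ} (hS : S ∈ s.types) : S ∈ s.colorOrder := by
  by_cases h : ∃ p ∈ s.masks, p.1 = S
  · exact List.mem_append_left _ (List.mem_map.mpr h)
  · push Not at h
    refine List.mem_append_right _ (List.mem_filter.mpr ⟨hS, ?_⟩)
    simpa [← Bool.not_eq_true, Nat.beq_eq] using h

/-- The position in the list of the vertex adjoined after `i` others. -/
def position (s : Config) (i : ℕ) : ℕ :=
  -- Lists grow at the head, so order of adjunction and position run oppositely.
  s.masks.length - 1 - i

/-- The trace of a vertex whose neighbors in the list are numbered by `l`. -/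
def encode (s : Config) : List ℕ → ℕ
  | [] => 0
  | i :: l => 2 ^ s.position i + s.encode l

/-- The vertices at positions `i` and `j` are distinct and nonadjacent, and all admissible traces
containing the first contain the second. -/
def checkCompare (s : Config) (i j : ℕ) : Bool :=
  Nat.blt i s.masks.length && Nat.blt j s.masks.length &&
    !Nat.beq (s.masks.getD i 0).1 (s.masks.getD j 0).1 &&
      !Nat.testBit (s.masks.getD i 0).1 j && s.types.all fun T => !T.testBit i || T.testBit j

/-- Search for a coloring of the traces in `todo` with four colors that extends the partial
coloring `done`. -/
def search (s : Config) : List ℕ → List (ℕ × ℕ) → Bool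
  | [], _ => true
  | S :: todo, done =>
    -- Many vertices may share the trace `S`, so their class must be independent.
    !s.canAdj S S && [0, 1, 2, 3].any fun c =>
      (done.all fun p => !Nat.beq p.2 c || !s.canAdj S p.1) &&
        s.search todo ((S, c) :: done)

/-- Apply `k` to `n`, evaluating `n` first; this prevents repeated evaluation in the kernel. -/
def forceNat {α : Sort*} (n : ℕ) (k : ℕ → α) : α :=
  n.rec (k 0) fun m _ => k (m + 1)

theorem forceNat_eq {α : Sort*} (n : ℕ) (k : ℕ → α) : forceNat n k = k n := by
  cases n <;> rfl

/-- Apply `k` to `l`, evaluating the entries of `l` first. -/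
def forceList {α : Sort*} : List ℕ → (List ℕ → α) → α
  | [], k => k []
  | n :: l, k => forceNat n fun n' => forceList l fun l' => k (n' :: l')

theorem forceList_eq {α : Sort*} (l : List ℕ) (k : List ℕ → α) : forceList l k = k l := by
  induction l generalizing k with
  | nil => rfl
  | cons n l ih => simp [forceList, forceNat_eq, ih]

/-- Apply `k` to `l`, evaluating the entries of `l` first. -/
def forcePairs {α : Sort*} : List (ℕ × ℕ) → (List (ℕ × ℕ) → α) → α
  | [], k => k []
  | p :: l, k => forceNat p.1 fun a => forceNat p.2 fun b => forcePairs l fun l' => k ((a, b) :: l')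

theorem forcePairs_eq {α : Sort*} (l : List (ℕ × ℕ)) (k : List (ℕ × ℕ) → α) :
    forcePairs l k = k l := by
  induction l generalizing k with
  | nil => rfl
  | cons n l ih => simp [forcePairs, forceNat_eq, ih]

/-- Apply `k` to `s`, evaluating `s` first. -/
def force {α : Sort*} (s : Config) (k : Config → α) : α :=
  forcePairs s.masks fun masks => forceList s.types fun types => k ⟨masks, types⟩

theorem force_eq {α : Sort*} (s : Config) (k : Config → α) : s.force k = k s := by
  simp [force, forceList_eq, forcePairs_eq]

/-- The configuration `s` describes `G` relative to the list `B`. -/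
def Describes {V : Type*} (s : Config) (G : SimpleGraph V) (B : List V) : Prop :=
  s.masks = (B.map (trace G B)).zipIdx ∧ ∀ v, trace G B v ∈ s.types

/-! ### Soundness of the tests on traces -/

section Sound

variable {V : Type*} {G : SimpleGraph V} {B : List V} {s : Config}

theorem Describes.mem_masks (h : s.Describes G B) {p : ℕ × ℕ} :
    p ∈ s.masks ↔ ∃ x, B[p.2]? = some x ∧ p.1 = trace G B x := by
  rw [h.1, List.mem_zipIdx_iff_getElem?, List.getElem?_map]
  simp [eq_comm]

theorem testBit_trace_eq_true {i : ℕ} {x : V} (hx : B[i]? = some x) (v : V) :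
    (trace G B v).testBit i = true ↔ G.Adj x v := by
  simp [testBit_trace, hx]

theorem testBit_trace_eq_false {i : ℕ} {x : V} (hx : B[i]? = some x) (v : V) :
    (trace G B v).testBit i = false ↔ ¬ G.Adj x v := by
  simp [← testBit_trace_eq_true hx]

/-- Together with `uv`, an edge among the common neighbors would form a `K₄`, and one among the
common nonneighbors an induced `2P₂`. -/
theorem Describes.canAdj_of_adj (h : s.Describes G B) (h2P2 : HFree G twoP2)
    (hK4 : HFree G (completeGraph (Fin 4))) {u v : V} (huv : G.Adj u v) :
    s.canAdj (trace G B u) (trace G B v) = true := by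
  simp only [canAdj, List.all_eq_true, h.mem_masks, Bool.and_eq_true, Bool.or_eq_true,
    Bool.not_eq_true', Nat.beq_eq]
  rintro ⟨m, i⟩ ⟨x, hx, rfl⟩
  change (trace G B x &&& (trace G B u &&& trace G B v) = 0 ∨
    (trace G B u &&& trace G B v).testBit i = false) ∧
    (trace G B x ||| (trace G B u ||| trace G B v) = trace G B u ||| trace G B v ∨
    (trace G B u ||| trace G B v).testBit i = true)
  constructor
  · by_contra! hcon
    obtain ⟨hne, hi⟩ := hcon
    obtain ⟨j, hj⟩ := Nat.exists_testBit_of_ne_zero hne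
    simp only [Nat.testBit_and, Bool.and_eq_true, ne_eq, Bool.not_eq_false,
      testBit_trace_eq_true hx] at hi hj
    obtain ⟨y, hy, hyx⟩ := (testBit_trace G B x j).mp hj.1
    simp only [testBit_trace_eq_true hy] at hj
    exact hK4.not_four_clique huv hi.1.symm hj.2.1.symm hi.2.symm hj.2.2.symm hyx.symm
  · by_contra! hcon
    obtain ⟨hne, hi⟩ := hcon
    simp only [Nat.testBit_or, Bool.or_eq_true, ne_eq, testBit_trace_eq_true hx] at hi
    push Not at hi
    refine hne (Nat.eq_of_testBit_eq fun j => ?_)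
    rw [Nat.testBit_or, Bool.or_eq_right_iff_imp, testBit_trace]
    rintro ⟨y, hy, hyx⟩
    rw [Nat.testBit_or, Bool.or_eq_true, testBit_trace_eq_true hy, testBit_trace_eq_true hy]
    by_contra! hcon
    exact h2P2.not_two_edges hyx huv hcon.1 hcon.2 hi.1 hi.2

/-- If `x` sees only `u`, `y` sees only `v`, and `x`, `y` are nonadjacent, then `xu` and `yv` form
an induced `2P₂`. -/
theorem Describes.canNonadj_of_not_adj (h : s.Describes G B) (h2P2 : HFree G twoP2) {u v : V}
    (huv : ¬ G.Adj u v) : s.canNonadj (trace G B u) (trace G B v) = true := by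
  simp only [canNonadj, List.all_eq_true, h.mem_masks, Bool.or_eq_true, Bool.not_eq_true']
  rintro ⟨m, i⟩ ⟨x, hx, rfl⟩
  simp only [testBit_trace_eq_true hx, testBit_trace_eq_false hx]
  by_contra! hcon
  obtain ⟨⟨hxu, hxv⟩, hne⟩ := hcon
  refine hne (Nat.beq_eq.mpr (Nat.eq_of_testBit_eq fun j => ?_))
  rw [Nat.testBit_or, Nat.testBit_or, Bool.or_eq_right_iff_imp, testBit_trace]
  rintro ⟨y, hy, hyv⟩
  rw [Bool.or_eq_true, testBit_trace_eq_true hy, testBit_trace_eq_true hy]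
  by_contra! hcon
  exact h2P2.not_two_edges hxu hyv (fun e => hcon.2 e.symm) hxv (fun e => hcon.1 e.symm) huv

theorem describes_nil (G : SimpleGraph V) : (⟨[], [0]⟩ : Config).Describes G [] := by
  simp [Describes, trace]

theorem Describes.extend (h : s.Describes G B) (h2P2 : HFree G twoP2)
    (hK4 : HFree G (completeGraph (Fin 4))) (x : V) {S : ℕ} (hS : trace G B x = S) :
    (s.extend S).Describes G (x :: B) := by
  subst hS
  refine ⟨?_, fun v => ?_⟩
  · classical
    simp only [Config.extend, List.map_cons, trace, SimpleGraph.irrefl, decide_false]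
    rw [List.zipIdx_cons, h.1]
    congr 1
    refine List.ext_getElem? fun i => ?_
    rw [List.getElem?_map, List.getElem?_zipIdx, List.getElem?_zipIdx, List.getElem?_map,
      List.getElem?_map]
    cases hi : B[i]? with
    | none => simp
    | some y =>
      have : (trace G B x).testBit i = decide (G.Adj x y) := by
        rw [Bool.eq_iff_iff, testBit_trace_eq_true hi, decide_eq_true_iff, G.adj_comm]
      simp [this, Nat.add_comm]
  · rw [Config.extend, List.mem_flatMap]
    refine ⟨_, h.2 v, ?_⟩
    by_cases hxv : G.Adj x v
    · simp [trace, hxv, h.canAdj_of_adj h2P2 hK4 hxv]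
    · simp [trace, hxv, h.canNonadj_of_not_adj h2P2 hxv]

theorem Describes.erase (h : s.Describes G B) {S : ℕ} (hS : ∀ v, trace G B v ≠ S) :
    (s.erase S).Describes G B := by
  refine ⟨h.1, fun v => ?_⟩
  simpa [Config.erase, h.2 v, ← Bool.not_eq_true, Nat.beq_eq] using hS v

/-- The partial coloring is kept as a relation: any two entries of equal color, even an entry with
itself, have traces that cannot be adjacent. -/
theorem exists_of_search (s : Config) (todo : List ℕ) (done : List (ℕ × ℕ))
    (hdone : ∀ p ∈ done, p.2 < 4 ∧ ∀ q ∈ done, p.2 = q.2 → s.canAdj p.1 q.1 = false)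
    (h : s.search todo done = true) :
    ∃ L : List (ℕ × ℕ), (∀ p ∈ L, p.2 < 4 ∧ ∀ q ∈ L, p.2 = q.2 → s.canAdj p.1 q.1 = false) ∧
      (∀ p ∈ done, p ∈ L) ∧ ∀ S ∈ todo, ∃ c, (S, c) ∈ L := by
  induction todo generalizing done with
  | nil => exact ⟨done, hdone, fun _ h => h, by simp⟩
  | cons S todo ih =>
    simp only [search, Bool.and_eq_true, Bool.not_eq_true', List.any_eq_true, List.all_eq_true,
      Bool.or_eq_true] at h
    obtain ⟨hSS, c, hc, hS, hrec⟩ := h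
    have hc4 : c < 4 := by
      simp only [List.mem_cons, List.not_mem_nil, or_false] at hc
      omega
    have hS' : ∀ p ∈ done, p.2 = c → s.canAdj S p.1 = false ∧ s.canAdj p.1 S = false := by
      intro p hp hpc
      rcases hS p hp with h | h
      · exact absurd hpc (Nat.ne_of_beq_eq_false h)
      · exact ⟨h, by rwa [canAdj_comm]⟩
    obtain ⟨L, hL, hsub, hmem⟩ := ih ((S, c) :: done) (by
      intro p hp
      rcases List.mem_cons.mp hp with rfl | hp
      · refine ⟨hc4, fun q hq hpq => ?_⟩
        rcases List.mem_cons.mp hq with rfl | hq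
        · exact hSS
        · exact (hS' q hq hpq.symm).1
      · refine ⟨(hdone p hp).1, fun q hq hpq => ?_⟩
        rcases List.mem_cons.mp hq with rfl | hq
        · exact (hS' p hp hpq).2
        · exact (hdone p hp).2 q hq hpq) hrec
    refine ⟨L, hL, fun p hp => hsub p (List.mem_cons_of_mem _ hp), fun U hU => ?_⟩
    rcases List.mem_cons.mp hU with rfl | hU
    · exact ⟨c, hsub _ List.mem_cons_self⟩
    · exact hmem U hU

theorem Describes.exists_comparable (h : s.Describes G B) {i j : ℕ}
    (hs : s.checkCompare i j = true) : ∃ u v, Comparable G u v := by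
  simp only [checkCompare, Bool.and_eq_true, Bool.not_eq_true', Nat.blt_eq, List.all_eq_true,
    Bool.or_eq_true, h.1, List.length_zipIdx, List.length_map] at hs
  obtain ⟨⟨⟨⟨hi, hj⟩, hne⟩, hadj⟩, hall⟩ := hs
  rw [List.getD_eq_getElem _ _ (by simpa using hi), List.getElem_zipIdx,
    List.getElem_map] at hne hadj
  rw [List.getD_eq_getElem _ _ (by simpa using hj), List.getElem_zipIdx, List.getElem_map] at hne
  have hi' : B[i]? = some B[i] := List.getElem?_eq_getElem hi
  have hj' : B[j]? = some B[j] := List.getElem?_eq_getElem hj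
  refine ⟨B[i], B[j], ?_, ?_, Or.inr fun v hv => ?_⟩
  · exact fun e => Nat.ne_of_beq_eq_false hne (by rw [e])
  · rw [testBit_trace_eq_false hj'] at hadj
    exact fun e => hadj e.symm
  · rw [mem_neighborSet] at hv ⊢
    rcases hall _ (h.2 v) with hf | hf
    · exact absurd hv ((testBit_trace_eq_false hi' v).mp hf)
    · exact (testBit_trace_eq_true hj' v).mp hf

theorem Describes.colorable_of_search (h : s.Describes G B) (h2P2 : HFree G twoP2)
    (hK4 : HFree G (completeGraph (Fin 4))) (hs : s.search s.colorOrder [] = true) :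
    G.Colorable 4 := by
  obtain ⟨L, hL, -, hmem⟩ := exists_of_search s s.colorOrder [] (by simp) hs
  -- Colors may be picked vertex by vertex, since the condition on `L` covers all pairs of its
  -- entries.
  choose c hc using fun v => hmem _ (mem_colorOrder (h.2 v))
  refine ⟨Coloring.mk (fun v => (⟨c v, (hL _ (hc v)).1⟩ : Fin 4)) fun {u v} huv heq => ?_⟩
  have h1 := (hL _ (hc u)).2 _ (hc v) (Fin.mk.inj heq)
  rw [h.canAdj_of_adj h2P2 hK4 huv] at h1
  cases h1

end Sound

end Config

/-! ### Case distinctions -/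

/-- A case distinction proving four-colorability of the graphs described by a configuration.
Vertices of the list are numbered in the order in which they were adjoined. -/
inductive CaseTree
  /-- The admissible traces can be colored. -/
  | color
  /-- The neighborhood of the vertex numbered `i` would be contained in that of the vertex
  numbered `j`. -/
  | compare (i j : ℕ)
  /-- Either some vertex has exactly the neighbors numbered by `l` in the list, or no vertex has. -/
  | split (l : List ℕ) (present absent : CaseTree)

namespace CaseTree

/-- Verify a case distinction. -/
def check : CaseTree → Config → Bool
  | color, s => Config.forceList s.colorOrder fun todo => s.search todo []
  | compare i j, s => s.checkCompare (s.position i) (s.position j)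
  | split l present absent, s =>
    Config.forceNat (s.encode l) fun S =>
      (s.extend S).force present.check && (s.erase S).force absent.check

theorem colorable_of_check {V : Type*} {G : SimpleGraph V} (h2P2 : HFree G twoP2)
    (hK4 : HFree G (completeGraph (Fin 4))) (hcomp : ∀ u v : V, ¬ Comparable G u v)
    (t : CaseTree) {s : Config} {B : List V} (h : s.Describes G B) (ht : t.check s = true) :
    G.Colorable 4 := by
  induction t generalizing s B with
  | color =>
    rw [check, Config.forceList_eq] at ht
    exact h.colorable_of_search h2P2 hK4 ht
  | compare i j =>
    obtain ⟨u, v, huv⟩ := h.exists_comparable ht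
    exact (hcomp u v huv).elim
  | split l present absent ihp iha =>
    simp only [check, Config.forceNat_eq, Config.force_eq, Bool.and_eq_true] at ht
    by_cases hS : ∃ v, trace G B v = s.encode l
    · obtain ⟨v, hv⟩ := hS
      exact ihp (h.extend h2P2 hK4 v hv) ht.1
    · exact iha (h.erase (not_exists.mp hS)) ht.2

end CaseTree

/-! ### Graphs containing `H₁` -/

open Config CaseTree

/-- The configuration of a graph relative to an induced copy of `H₁`. -/
def configH1 : Config :=
  -- The lists give the earlier neighbors of `w, 1, …, 6` in turn.
  [[], [0], [0], [1], [0, 1, 2], [0, 1, 2, 3], [2, 3, 4]].foldl (fun s l => s.extend (s.encode l))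
    ⟨[], [0]⟩

theorem configH1_describes {V : Type*} {G : SimpleGraph V} (h2P2 : HFree G twoP2)
    (hK4 : HFree G (completeGraph (Fin 4))) (f : graphH1 ↪g G) :
    configH1.Describes G ([6, 5, 4, 3, 2, 1, 0].map f) := by
  have adj (i j : Fin 7) : G.Adj (f i) (f j) ↔ (SimpleGraph.fromEdgeSet _).Adj i j :=
    f.map_adj_iff
  refine Describes.extend (Describes.extend (Describes.extend (Describes.extend (Describes.extend
    (Describes.extend (Describes.extend (describes_nil G) h2P2 hK4 (f 0) ?_) h2P2 hK4 (f 1) ?_)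
    h2P2 hK4 (f 2) ?_) h2P2 hK4 (f 3) ?_) h2P2 hK4 (f 4) ?_) h2P2 hK4 (f 5) ?_) h2P2 hK4 (f 6) ?_
  all_goals
    simp [trace_cons_of_adj, trace_cons_of_not_adj, trace_nil, adj, encode, position, extend]

/-- The case distinction for graphs containing `H₁`. The vertices of `H₁` are `0, …, 6`, and those
found in the cases are numbered from `7` on. -/
def treeH1 : CaseTree :=
  split [1, 2, 3, 4]
      (split [4, 5]
          (split [1, 2, 5, 6, 7, 8] (compare 3 9)
            (split [1, 4, 5, 6] (compare 8 0)
              (split [0, 5, 6, 7] color (split [0, 2, 3, 7, 8] (compare 6 7) color))))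
        (split [0, 3, 4, 7] (split [2, 3, 4, 5, 8] color color)
          (split [0, 3, 4] (split [1, 2, 5, 6, 7, 8] color color)
            (split [0, 2, 3, 7]
                (split [0, 3, 4, 5, 8] color (split [2, 3, 4, 5, 8] color color))
              (split [0, 1, 6, 7] (split [1, 4, 5, 6, 8] color color) color)))))
    (split [0, 3, 4]
        (split [2, 3, 4, 5, 7] (split [0, 3, 4] color (split [0, 1, 2, 3, 7] color color))
          (split [0, 5, 6, 7]
              (split [1, 4, 5, 6, 7, 8] color
                (split [1, 4, 5, 6, 7] color
                  (split [1, 2, 5, 6, 7, 8] color (split [2, 3, 4, 5, 8] color color))))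
            (compare 7 1)))
      (split [0, 2, 3]
          (split [2, 3, 4, 5, 7] color
            (split [2, 3, 4, 5] (split [1, 4, 5, 6, 7, 8] (compare 3 9) color)
              (split [4, 5, 7] (split [1, 2, 5, 6, 7, 8] color (compare 8 0)) color)))
        (split [1, 2]
            (split [2, 3, 4, 5, 7] color
              (split [2, 3, 4, 5] (split [0, 1, 2, 3, 6, 7, 8] color (compare 7 5)) color))
          color)))

theorem treeH1_check : configH1.force treeH1.check = true := by
  decide +kernel

theorem lemma3p1 {V : Type*} [Finite V] (G : SimpleGraph V)
    (hconn : G.Connected)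
    (h2P2 : HFree G twoP2)
    (hK4 : HFree G (SimpleGraph.completeGraph (Fin 4)))
    (hcomp : ∀ u v : V, ¬ Comparable G u v)
    (hH1 : graphH1.IsIndContained G) :
    G.chromaticNumber ≤ 4 := by
  obtain ⟨f⟩ := hH1
  exact (colorable_of_check h2P2 hK4 hcomp treeH1 (configH1_describes h2P2 hK4 f)
    (by simpa only [force_eq] using treeH1_check)).chromaticNumber_le
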